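/- Let $(E_1,d_1)$ and $(E_2,d_2)$ be complete separable metric spaces with their Borel $\sigma$-algebras, and let $(X_n)_{n\ge 0}$ and $(Y_n)_{n\ge 0}$ be sequences of random elements of $E_1$ and $E_2$ respectively, all defined on one probability space $(\Omega,\mathcal F,\mathbb P)$. Write $P_{X_n}$, $P_{Y_n}$, $P_{(X_n,Y_n)}$ for the laws of $X_n$, $Y_n$ and $(X_n,Y_n)$. Equip $E_1\times E_2$ with either of the metrics $$r\big((x_1,y_1),(x_2,y_2)\big)=\max\{d_1(x_1,x_2),d_2(y_1,y_2)\},\qquad d\big((x_1,y_1),(x_2,y_2)\big)=d_1(x_1,x_2)+d_2(y_1,y_2),$$ and let $\pi$ be the corresponding Lévy–Prokhorov metric on probability measures on $E_1\times E_2$, $$\pi(\mu,\nu)=\inf\{\varepsilon>0:\ \mu(A)\le \nu(A^{\varepsilon})+\varepsilon\ \text{ and }\ \nu(A)\le\mu(A^\varepsilon)+\varepsilon\ \text{ for all Borel sets } A\},$$ where $A^\varepsilon$ is the open $\varepsilon$-neighbourhood of $A$. Let $\Pi$ be the set of all product measures $\mu_1\times\mu_2$ with $\mu_1$, $\mu_2$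 Borel probability measures on $E_1$ and $E_2$, and put $\pi(\mu,\Pi)=\inf_{\nu\in\Pi}\pi(\mu,\nu)$. **Proposition.** For each of the two choices of metric on $E_1\times E_2$, the following conditions are equivalent: 1. (AI-1) for every bounded uniformly continuous function $h:E_1\times E_2\to\mathbb R$, $$\int h\,dP_{(X_n,Y_n)}-\int h\,d(P_{X_n}\times P_{Y_n})\to 0,\qquad n\to\infty;$$ 2. $\pi\big(P_{(X_n,Y_n)},\Pi\big)\to 0$ as $n\to\infty$. -/

import Mathlib

open MeasureTheory Filter Topology

/-- Asymptotic independence of two sequences of random elements in the sense of test functions: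
for every bounded uniformly continuous `h : E₁ × E₂ → ℝ`, the integral of `h` against the joint
law of `(X n, Y n)` minus its integral against the product of the marginal laws tends to `0`.
(The uniform structure on `E₁ × E₂` is the product one, which is the one induced both by the
maximum metric and by the sum metric.) -/
def AI1 {Ω E₁ E₂ : Type*} [MeasurableSpace Ω]
    [MetricSpace E₁] [MeasurableSpace E₁] [MetricSpace E₂] [MeasurableSpace E₂]
    (P : Measure Ω) (X : ℕ → Ω → E₁) (Y : ℕ → Ω → E₂) : Prop :=
  ∀ h : E₁ × E₂ → ℝ, UniformContinuous h → (∃ C : ℝ, ∀ z, |h z| ≤ C) →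
    Tendsto
      (fun n => (∫ z, h z ∂(P.map fun ω => (X n ω, Y n ω)))
        - ∫ z, h z ∂((P.map (X n)).prod (P.map (Y n))))
      atTop (𝓝 0)

/-- The set `Π` of all products `μ₁ × μ₂` of probability measures. -/
def productLaws (E₁ E₂ : Type*) [MeasurableSpace E₁] [MeasurableSpace E₂] :
    Set (Measure (E₁ × E₂)) :=
  {ν | ∃ (μ₁ : Measure E₁) (μ₂ : Measure E₂),
    IsProbabilityMeasure μ₁ ∧ IsProbabilityMeasure μ₂ ∧ ν = μ₁.prod μ₂}

/-- The distance `π(μ, Π)`, where `π` is the Lévy-Prokhorov metric for the metric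
`r((x₁, y₁), (x₂, y₂)) = max (d₁(x₁, x₂)) (d₂(y₁, y₂))` on `E₁ × E₂`
(Mathlib's metric on a product type). -/
noncomputable def lpDistToProductsMax {E₁ E₂ : Type*}
    [MetricSpace E₁] [MeasurableSpace E₁] [MetricSpace E₂] [MeasurableSpace E₂]
    (μ : Measure (E₁ × E₂)) : ℝ :=
  ⨅ ν : productLaws E₁ E₂, levyProkhorovDist μ (ν : Measure (E₁ × E₂))

/-- The distance `π(μ, Π)`, where `π` is the Lévy-Prokhorov metric for the metric
`d((x₁, y₁), (x₂, y₂)) = d₁(x₁, x₂) + d₂(y₁, y₂)` on `E₁ × E₂`: the measures are carried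
over to `WithLp 1 (E₁ × E₂)`, which is `E₁ × E₂` with this metric and the same `σ`-algebra. -/
noncomputable def lpDistToProductsSum {E₁ E₂ : Type*}
    [MetricSpace E₁] [MeasurableSpace E₁] [MetricSpace E₂] [MeasurableSpace E₂]
    (μ : Measure (E₁ × E₂)) : ℝ :=
  ⨅ ν : productLaws E₁ E₂,
    levyProkhorovDist (μ.map (WithLp.toLp 1)) ((ν : Measure (E₁ × E₂)).map (WithLp.toLp 1))

/-!
The two conditions for the two metrics are linked in a cycle: test-function convergence `AI1`
implies convergence of the distance for the sum metric, which implies convergence of the (smaller)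
distance for the maximum metric, which implies `AI1`.

*From distances to test functions.* If the joint law of `(X n, Y n)` is within `δ` of some product
`ν₁ × ν₂`, then, the projections being `1`-Lipschitz, the marginal laws are within `δ` of `ν₁` and
`ν₂` (`levyProkhorovDist_map_le`). For a function `h` bounded by `C` and oscillating by at most `η`
at scale `δ`, measures at Lévy-Prokhorov distance less than `δ` have integrals of `h` differing by
at most `η + 2 * C * δ` (`abs_integral_sub_le_of_levyProkhorovDist_lt`). Together with Fubini this
allows `ν₁ × ν₂` to be replaced by the product of the marginals
(`abs_integral_sub_integral_prod_marginals_le`).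

*From test functions to distances.* `AI1` controls one test function at a time, without any
tightness, while the Lévy-Prokhorov metric requires control that is uniform over Borel sets `A`.
The `K`-Lipschitz functions into `[0, 1]` form a compact space for pointwise convergence, on which
integration is continuous. The Baire category theorem then gives uniform control of
`∫ h dμₙ - ∫ h dνₙ` over all such `h` that vanish near a suitable finite set `F`
(`exists_finite_eventually_abs_integral_sub_le`). A bump function of an arbitrary set `A` splits
into a part vanishing near `F` and a bump function of a neighbourhood of a subset of `F`; only
finitely many of the latter exist, so pointwise control suffices for them
(`tendsto_levyProkhorovDist_of_tendsto_integral_sub`). This is applied to the joint laws and the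
products of the marginal laws.
-/

open scoped NNReal ENNReal

/-! ### Lipschitz functions with values in the unit interval -/

/-- The `K`-Lipschitz functions `E → [0, 1]`. As a subset of `E → ℝ` it carries the topology of
pointwise convergence. -/
def lipschitzUnit (E : Type*) [PseudoMetricSpace E] (K : ℝ≥0) : Set (E → ℝ) :=
  {f | LipschitzWith K f ∧ ∀ x, f x ∈ Set.Icc (0 : ℝ) 1}

section Compactness

variable {E : Type*} [PseudoMetricSpace E]

lemma isCompact_lipschitzUnit (K : ℝ≥0) : IsCompact (lipschitzUnit E K) := by
  have hc : IsClosed (lipschitzUnit E K) := by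
    have : lipschitzUnit E K = (⋂ x, ⋂ y, {f : E → ℝ | dist (f x) (f y) ≤ K * dist x y}) ∩
        ⋂ x, {f : E → ℝ | f x ∈ Set.Icc (0 : ℝ) 1} := by
      ext f
      simp [lipschitzUnit, lipschitzWith_iff_dist_le_mul]
    rw [this]
    refine IsClosed.inter (isClosed_iInter fun x => isClosed_iInter fun y => ?_)
      (isClosed_iInter fun x => ?_)
    · exact isClosed_le ((continuous_apply x).dist (continuous_apply y)) continuous_const
    · exact isClosed_Icc.preimage (continuous_apply x)
  refine (isCompact_univ_pi fun _ : E => isCompact_Icc (a := (0 : ℝ)) (b := 1)).of_isClosed_subset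
    hc fun f hf x _ => hf.2 x

/-- Restriction to a countable dense set is a topological embedding of the compact space
`lipschitzUnit E K`, so pointwise convergence is first countable there. -/
lemma firstCountableTopology_lipschitzUnit [TopologicalSpace.SeparableSpace E] [Nonempty E]
    (K : ℝ≥0) : FirstCountableTopology (lipschitzUnit E K) := by
  have : CompactSpace (lipschitzUnit E K) :=
    isCompact_iff_compactSpace.mp (isCompact_lipschitzUnit K)
  let r : lipschitzUnit E K → ℕ → ℝ := fun f i => f.1 (TopologicalSpace.denseSeq E i)
  have hr : Continuous r :=
    continuous_pi fun i => (continuous_apply _).comp continuous_subtype_val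
  have hinj : Function.Injective r := by
    intro f g hfg
    refine Subtype.ext ?_
    refine (TopologicalSpace.denseRange_denseSeq E).equalizer f.2.1.continuous g.2.1.continuous ?_
    exact hfg
  exact (hr.isClosedEmbedding hinj).isInducing.firstCountableTopology

lemma thickenedIndicator_mem_lipschitzUnit {δ : ℝ} (hδ : 0 < δ) (A : Set E) :
    (fun x => (thickenedIndicator hδ A x : ℝ)) ∈ lipschitzUnit E δ.toNNReal⁻¹ := by
  refine ⟨fun x y => lipschitzWith_thickenedIndicator hδ A x y, fun x => ⟨NNReal.coe_nonneg _, ?_⟩⟩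
  exact_mod_cast thickenedIndicator_le_one hδ A x

variable [MeasurableSpace E] [OpensMeasurableSpace E]

lemma integrable_of_mem_lipschitzUnit {K : ℝ≥0} {f : E → ℝ} (hf : f ∈ lipschitzUnit E K)
    (μ : Measure E) [IsFiniteMeasure μ] : Integrable f μ := by
  refine Integrable.of_bound hf.1.continuous.measurable.aestronglyMeasurable 1
    (Eventually.of_forall fun x => ?_)
  rw [Real.norm_eq_abs, abs_le]
  exact ⟨by linarith [(hf.2 x).1], (hf.2 x).2⟩

lemma continuous_integral_lipschitzUnit [TopologicalSpace.SeparableSpace E] [Nonempty E]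
    (K : ℝ≥0) (μ : Measure E) [IsFiniteMeasure μ] :
    Continuous fun f : lipschitzUnit E K => ∫ x, f.1 x ∂μ := by
  have := firstCountableTopology_lipschitzUnit (E := E) K
  refine continuous_iff_continuousAt.2 fun f => ?_
  refine tendsto_integral_filter_of_dominated_convergence (fun _ => (1 : ℝ)) ?_ ?_
    (integrable_const _) ?_
  · exact Eventually.of_forall fun g => g.2.1.continuous.measurable.aestronglyMeasurable
  · refine Eventually.of_forall fun g => Eventually.of_forall fun x => ?_
    rw [Real.norm_eq_abs, abs_le]
    exact ⟨by linarith [(g.2.2 x).1], (g.2.2 x).2⟩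
  · exact Eventually.of_forall fun x =>
      ((continuous_apply x).comp continuous_subtype_val).continuousAt

end Compactness

/-! ### From integrals of test functions to the Lévy-Prokhorov metric -/

section Schur

variable {E : Type*} [PseudoMetricSpace E] [MeasurableSpace E] [OpensMeasurableSpace E]

/-- A Schur property of differences of probability measures: pointwise convergence to `0` on
`lipschitzUnit E δ⁻¹` is uniform over the functions that vanish near some finite set `F`.

By the Baire category theorem on the compact space `lipschitzUnit E δ⁻¹`, the differences are
eventually at most `ε / 2` on a nonempty open set of functions. Openness for pointwise convergence
constrains a function on a finite set `F` only, so a point `f₀` of the open set can be truncated to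
a function `f₁` supported within `δ` of `F`. If `h` vanishes there, then `f₁ + h = max f₁ h` is
again `δ⁻¹`-Lipschitz with values in `[0, 1]`, lies in the open set, and `h = (f₁ + h) - f₁`. -/
lemma exists_finite_eventually_abs_integral_sub_le [TopologicalSpace.SeparableSpace E]
    (μ ν : ℕ → Measure E) [∀ n, IsProbabilityMeasure (μ n)] [∀ n, IsProbabilityMeasure (ν n)]
    {δ : ℝ} (hδ : 0 < δ)
    (H : ∀ h ∈ lipschitzUnit E δ.toNNReal⁻¹,
      Tendsto (fun n => ∫ x, h x ∂(μ n) - ∫ x, h x ∂(ν n)) atTop (𝓝 0))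
    {ε : ℝ} (hε : 0 < ε) :
    ∃ F : Finset E, ∀ᶠ n in atTop, ∀ h ∈ lipschitzUnit E δ.toNNReal⁻¹,
      (∀ x ∈ Metric.thickening δ (F : Set E), h x = 0) →
        |∫ x, h x ∂(μ n) - ∫ x, h x ∂(ν n)| ≤ ε := by
  have : Nonempty E := (μ 0).nonempty_of_neZero
  set K := δ.toNNReal⁻¹ with hK
  have : CompactSpace (lipschitzUnit E K) :=
    isCompact_iff_compactSpace.mp (isCompact_lipschitzUnit K)
  have : Nonempty (lipschitzUnit E K) := ⟨⟨_, thickenedIndicator_mem_lipschitzUnit hδ ∅⟩⟩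
  let C : ℕ → Set (lipschitzUnit E K) := fun k =>
    {f | ∀ n ≥ k, |∫ x, f.1 x ∂(μ n) - ∫ x, f.1 x ∂(ν n)| ≤ ε / 2}
  have hCc : ∀ k, IsClosed (C k) := by
    intro k
    have : C k = ⋂ n, ⋂ _ : n ≥ k,
        {f | |∫ x, f.1 x ∂(μ n) - ∫ x, f.1 x ∂(ν n)| ≤ ε / 2} := by
      ext f
      simp [C]
    rw [this]
    exact isClosed_iInter fun n => isClosed_iInter fun _ => isClosed_le
      ((continuous_integral_lipschitzUnit K (μ n)).sub
        (continuous_integral_lipschitzUnit K (ν n))).abs continuous_const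
  have hCu : ⋃ k, C k = Set.univ := by
    refine Set.eq_univ_of_forall fun f => Set.mem_iUnion.2 ?_
    obtain ⟨k, hk⟩ := Metric.tendsto_atTop.1 (H f.1 f.2) (ε / 2) (by positivity)
    refine ⟨k, fun n hn => ?_⟩
    have := hk n hn
    rw [Real.dist_eq, sub_zero] at this
    exact this.le
  obtain ⟨k, f₀, hf₀⟩ := nonempty_interior_of_iUnion_of_closed hCc hCu
  have hnhds : C k ∈ 𝓝 f₀ := mem_interior_iff_mem_nhds.1 hf₀
  rw [nhds_subtype, mem_comap] at hnhds
  obtain ⟨U, hU, hUC⟩ := hnhds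
  rw [nhds_pi, Filter.mem_pi'] at hU
  obtain ⟨F, t, ht, htU⟩ := hU
  -- Membership of `g` in `C k` is guaranteed by the values of `g` on `F` alone.
  have hmem : ∀ g (hg : g ∈ lipschitzUnit E K), (∀ x ∈ F, g x = f₀.1 x) →
      (⟨g, hg⟩ : lipschitzUnit E K) ∈ C k := by
    intro g hg hgF
    refine hUC (htU fun x hx => ?_)
    simpa only [hgF x hx] using mem_of_mem_nhds (ht x)
  refine ⟨F, eventually_atTop.2 ⟨k, fun n hn h hh h0 => ?_⟩⟩
  -- `f₁` agrees with `f₀` on `F`, but vanishes away from `F`.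
  let f₁ : E → ℝ := fun x => min (f₀.1 x) (thickenedIndicator hδ (F : Set E) x)
  have hind := thickenedIndicator_mem_lipschitzUnit hδ (F : Set E)
  have hf₁ : f₁ ∈ lipschitzUnit E K := by
    refine ⟨?_, fun x => ⟨le_min (f₀.2.2 x).1 (hind.2 x).1, (min_le_left _ _).trans (f₀.2.2 x).2⟩⟩
    exact (max_self K) ▸ f₀.2.1.min hind.1
  have hf₁F : ∀ x ∈ F, f₁ x = f₀.1 x := by
    intro x hx
    simp only [f₁]
    rw [thickenedIndicator_one hδ _ (Finset.mem_coe.2 hx)]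
    exact min_eq_left (f₀.2.2 x).2
  have hf₁0 : ∀ x ∉ Metric.thickening δ (F : Set E), f₁ x = 0 := by
    intro x hx
    simp only [f₁]
    rw [thickenedIndicator_zero hδ _ hx]
    exact min_eq_right (f₀.2.2 x).1
  have hmax : (fun x => max (f₁ x) (h x)) = fun x => f₁ x + h x := by
    funext x
    by_cases hx : x ∈ Metric.thickening δ (F : Set E)
    · rw [h0 x hx, add_zero, max_eq_left (hf₁.2 x).1]
    · rw [hf₁0 x hx, zero_add, max_eq_right (hh.2 x).1]
  have hsum : (fun x => f₁ x + h x) ∈ lipschitzUnit E K := by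
    rw [← hmax]
    refine ⟨?_, fun x => ⟨le_max_of_le_left (hf₁.2 x).1, max_le (hf₁.2 x).2 (hh.2 x).2⟩⟩
    exact (max_self K) ▸ hf₁.1.max hh.1
  have hsumF : ∀ x ∈ F, f₁ x + h x = f₀.1 x := by
    intro x hx
    rw [h0 x (Metric.self_subset_thickening hδ _ hx), add_zero, hf₁F x hx]
  have e₁ := hmem f₁ hf₁ hf₁F n hn
  have e₂ := hmem _ hsum hsumF n hn
  simp only at e₁ e₂
  rw [integral_add (integrable_of_mem_lipschitzUnit hf₁ _) (integrable_of_mem_lipschitzUnit hh _),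
    integral_add (integrable_of_mem_lipschitzUnit hf₁ _) (integrable_of_mem_lipschitzUnit hh _)]
    at e₂
  rw [abs_le] at *
  constructor <;> linarith [e₁.1, e₁.2, e₂.1, e₂.2]

/-- If the integrals of each single Lipschitz function `E → [0, 1]` against `μ n` and `ν n` merge,
then `μ n` and `ν n` merge in the Lévy-Prokhorov metric; no tightness is required. -/
theorem tendsto_levyProkhorovDist_of_tendsto_integral_sub [TopologicalSpace.SeparableSpace E]
    (μ ν : ℕ → Measure E) [∀ n, IsProbabilityMeasure (μ n)] [∀ n, IsProbabilityMeasure (ν n)]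
    (H : ∀ K, ∀ h ∈ lipschitzUnit E K,
      Tendsto (fun n => ∫ x, h x ∂(μ n) - ∫ x, h x ∂(ν n)) atTop (𝓝 0)) :
    Tendsto (fun n => levyProkhorovDist (μ n) (ν n)) atTop (𝓝 0) := by
  have key : ∀ ε > 0, ∀ᶠ n in atTop, levyProkhorovDist (μ n) (ν n) ≤ ε := by
    intro ε hε
    obtain ⟨α, hα, rfl⟩ : ∃ α > 0, ε = 8 * α := ⟨ε / 8, by positivity, by ring⟩
    have hα2 : 0 < 2 * α := by positivity
    obtain ⟨F, hF⟩ := exists_finite_eventually_abs_integral_sub_le μ ν hα (H _) hα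
    let b : Set E → E → ℝ := fun S x => thickenedIndicator hα2 (Metric.thickening (3 * α) S) x
    have hb : ∀ S, b S ∈ lipschitzUnit E (2 * α).toNNReal⁻¹ := fun S =>
      thickenedIndicator_mem_lipschitzUnit hα2 _
    -- The finitely many functions `b S` are handled one by one.
    have hS : ∀ᶠ n in atTop, ∀ S ∈ F.powerset,
        |∫ x, b S x ∂(μ n) - ∫ x, b S x ∂(ν n)| ≤ α := by
      refine (Finset.eventually_all _).2 fun S _ => ?_
      have := (H _ _ (hb S)).abs
      rw [abs_zero] at this
      exact (this.eventually_lt_const hα).mono fun _ h => h.le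
    filter_upwards [hF, hS] with n hn hSn
    refine levyProkhorovDist_le_of_forall_le _ _ (by positivity) fun ε' A hε' hA => ?_
    classical
    -- The function `b S + g` separates `A` from the complement of its `8 * α`-thickening: `b S`
    -- takes care of the points of `A` near `F`, and `g`, which vanishes near `F`, of the others.
    let S : Finset E := F.filter fun x => x ∈ Metric.thickening (3 * α) A
    let a : E → ℝ := fun x => thickenedIndicator hα2 (A \ Metric.thickening (3 * α) (F : Set E)) x
    have ha : a ∈ lipschitzUnit E (2 * α).toNNReal⁻¹ := thickenedIndicator_mem_lipschitzUnit hα2 _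
    let g : E → ℝ := fun x => max (a x - b S x) 0
    have hg : g ∈ lipschitzUnit E α.toNNReal⁻¹ := by
      refine ⟨?_, fun x => ⟨le_max_right _ _, ?_⟩⟩
      · have hK : (2 * α).toNNReal⁻¹ + (2 * α).toNNReal⁻¹ = α.toNNReal⁻¹ := by
          rw [Real.toNNReal_mul zero_le_two]
          have : α.toNNReal ≠ 0 := (Real.toNNReal_pos.2 hα).ne'
          have h2 : (2 : ℝ).toNNReal = 2 := by simp
          rw [h2]
          field_simp
          norm_num
        rw [← hK]
        exact (ha.1.sub (hb S).1).max_const 0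
      · exact max_le (by linarith [(ha.2 x).2, ((hb S).2 x).1]) zero_le_one
    have hg0 : ∀ x ∈ Metric.thickening α (F : Set E), g x = 0 := by
      intro x hx
      have hax : a x = 0 := by
        simp only [a]
        rw [thickenedIndicator_zero hα2, NNReal.coe_zero]
        intro hx'
        -- A point within `α` of `F` and `2 * α` of `z` would put `z` within `3 * α` of `F`.
        obtain ⟨y, hy, hxy⟩ := Metric.mem_thickening_iff.1 hx
        obtain ⟨z, hz, hxz⟩ := Metric.mem_thickening_iff.1 hx'
        refine hz.2 (Metric.mem_thickening_iff.2 ⟨y, hy, ?_⟩)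
        linarith [dist_triangle_left z y x]
      simp only [g]
      rw [hax]
      exact max_eq_right (by linarith [((hb S).2 x).1])
    have hsum : ∀ x, b S x + g x = max (a x) (b S x) := by
      intro x
      simp only [g]
      rw [← max_add_add_left]
      simp
    have hone : ∀ x ∈ A, 1 ≤ b S x + g x := by
      intro x hx
      rw [hsum]
      by_cases hxF : x ∈ Metric.thickening (3 * α) (F : Set E)
      · obtain ⟨y, hy, hxy⟩ := Metric.mem_thickening_iff.1 hxF
        refine le_max_of_le_right ?_
        have hx' : x ∈ Metric.thickening (3 * α) (S : Set E) := by
          refine Metric.mem_thickening_iff.2 ⟨y, ?_, hxy⟩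
          simp only [S, Finset.coe_filter, Set.mem_ofPred_eq]
          exact ⟨hy, Metric.mem_thickening_iff.2 ⟨x, hx, by rwa [dist_comm]⟩⟩
        simp only [b]
        rw [thickenedIndicator_one hα2 _ hx', NNReal.coe_one]
      · refine le_max_of_le_left ?_
        simp only [a]
        have hx' : x ∈ A \ Metric.thickening (3 * α) (F : Set E) := ⟨hx, hxF⟩
        rw [thickenedIndicator_one hα2 _ hx', NNReal.coe_one]
    have hle : ∀ x, b S x + g x ≤ (Metric.thickening (8 * α) A).indicator 1 x := by
      intro x
      rw [hsum]
      by_cases hx : x ∈ Metric.thickening (8 * α) A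
      · rw [Set.indicator_of_mem hx]
        exact max_le (ha.2 x).2 ((hb S).2 x).2
      · rw [Set.indicator_of_notMem hx]
        refine max_le (le_of_eq ?_) (le_of_eq ?_)
        · simp only [a]
          rw [thickenedIndicator_zero hα2, NNReal.coe_zero]
          intro hx'
          obtain ⟨z, hz, hxz⟩ := Metric.mem_thickening_iff.1 hx'
          exact hx (Metric.mem_thickening_iff.2 ⟨z, hz.1, by linarith⟩)
        · simp only [b]
          rw [thickenedIndicator_zero hα2, NNReal.coe_zero]
          intro hx'
          obtain ⟨z, hz, hxz⟩ := Metric.mem_thickening_iff.1 hx'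
          obtain ⟨y, hy, hzy⟩ := Metric.mem_thickening_iff.1 hz
          have hyA := (Finset.mem_filter.1 (Finset.mem_coe.1 hy)).2
          -- `8 * α = 2 * α + 3 * α + 3 * α`, through a point of `S` that is close to `A`.
          obtain ⟨w, hw, hyw⟩ := Metric.mem_thickening_iff.1 hyA
          refine hx (Metric.mem_thickening_iff.2 ⟨w, hw, ?_⟩)
          linarith [dist_triangle x z w, dist_triangle z y w]
    have hTm : MeasurableSet (Metric.thickening (8 * α) A) :=
      Metric.isOpen_thickening.measurableSet
    have hint : ∀ ρ : Measure E, IsProbabilityMeasure ρ →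
        Integrable (b S) ρ ∧ Integrable g ρ := fun ρ _ =>
      ⟨integrable_of_mem_lipschitzUnit (hb S) ρ, integrable_of_mem_lipschitzUnit hg ρ⟩
    obtain ⟨iμb, iμg⟩ := hint (μ n) inferInstance
    obtain ⟨iνb, iνg⟩ := hint (ν n) inferInstance
    have h1 : (μ n).real A ≤ ∫ x, b S x ∂(μ n) + ∫ x, g x ∂(μ n) := by
      rw [← integral_add iμb iμg, ← integral_indicator_one hA]
      refine integral_mono ((integrable_const (1 : ℝ)).indicator hA) (iμb.add iμg) fun x => ?_
      by_cases hx : x ∈ A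
      · rw [Set.indicator_of_mem hx]
        exact hone x hx
      · rw [Set.indicator_of_notMem hx]
        exact add_nonneg ((hb S).2 x).1 (hg.2 x).1
    have h2 : ∫ x, b S x ∂(ν n) + ∫ x, g x ∂(ν n) ≤ (ν n).real (Metric.thickening (8 * α) A) := by
      rw [← integral_add iνb iνg, ← integral_indicator_one hTm]
      exact integral_mono (iνb.add iνg) ((integrable_const (1 : ℝ)).indicator hTm) hle
    have h3 := (abs_le.1 (hn g hg hg0)).2
    have h4 := (abs_le.1 (hSn S (Finset.mem_powerset.2 (Finset.filter_subset _ _)))).2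
    have h5 : (ν n).real (Metric.thickening (8 * α) A) ≤ (ν n).real (Metric.thickening ε' A) :=
      measureReal_mono (Metric.thickening_mono hε'.le A)
    have h6 : (μ n).real A ≤ (ν n).real (Metric.thickening ε' A) + ε' := by linarith
    rw [← ofReal_measureReal, ← ofReal_measureReal (μ := ν n),
      ← ENNReal.ofReal_add measureReal_nonneg (by linarith)]
    exact ENNReal.ofReal_le_ofReal h6
  refine Metric.tendsto_nhds.2 fun ε hε => ?_
  filter_upwards [key (ε / 2) (by positivity)] with n hn
  have h0 : 0 ≤ levyProkhorovDist (μ n) (ν n) := ENNReal.toReal_nonneg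
  rw [Real.dist_eq, sub_zero, abs_of_nonneg h0]
  linarith

end Schur

/-! ### From the Lévy-Prokhorov metric to integrals of test functions -/

lemma levyProkhorovEDist_map_le {E F : Type*} [PseudoMetricSpace E] [MeasurableSpace E]
    [PseudoMetricSpace F] [MeasurableSpace F] (μ ν : Measure E) [IsFiniteMeasure μ]
    [IsFiniteMeasure ν] {φ : E → F} (hφ : LipschitzWith 1 φ) (hφm : Measurable φ) :
    levyProkhorovEDist (μ.map φ) (ν.map φ) ≤ levyProkhorovEDist μ ν := by
  have hsub : ∀ (r : ℝ) (B : Set F),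
      Metric.thickening r (φ ⁻¹' B) ⊆ φ ⁻¹' Metric.thickening r B := by
    intro r B x hx
    obtain ⟨y, hy, hxy⟩ := Metric.mem_thickening_iff.1 hx
    refine Metric.mem_thickening_iff.2 ⟨φ y, hy, ?_⟩
    simpa using (hφ.dist_le_mul x y).trans_lt (by simpa using hxy)
  have hpush : ∀ (ρ : Measure E) (r : ℝ) (B : Set F),
      ρ (Metric.thickening r (φ ⁻¹' B)) ≤ ρ.map φ (Metric.thickening r B) := fun ρ r B =>
    (measure_mono (hsub r B)).trans (Measure.le_map_apply hφm.aemeasurable _)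
  refine levyProkhorovEDist_le_of_forall _ _ _ fun ε B hε _ hB => ?_
  rw [Measure.map_apply hφm hB, Measure.map_apply hφm hB]
  exact ⟨(left_measure_le_of_levyProkhorovEDist_lt hε (hφm hB)).trans
      (by gcongr; exact hpush _ _ _),
    (right_measure_le_of_levyProkhorovEDist_lt hε (hφm hB)).trans (by gcongr; exact hpush _ _ _)⟩

lemma levyProkhorovDist_map_le {E F : Type*} [PseudoMetricSpace E] [MeasurableSpace E]
    [PseudoMetricSpace F] [MeasurableSpace F] (μ ν : Measure E) [IsFiniteMeasure μ]
    [IsFiniteMeasure ν] {φ : E → F} (hφ : LipschitzWith 1 φ) (hφm : Measurable φ) :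
    levyProkhorovDist (μ.map φ) (ν.map φ) ≤ levyProkhorovDist μ ν :=
  ENNReal.toReal_mono (levyProkhorovEDist_ne_top μ ν) (levyProkhorovEDist_map_le μ ν hφ hφm)

section Integral

variable {E : Type*} [PseudoMetricSpace E] [MeasurableSpace E] [OpensMeasurableSpace E]

/-- Layer cake: passing from `μ` to `ν` thickens each superlevel set of `h` by `δ`, which raises
the level by at most `η`, and costs a mass `δ` over a range of levels of length `2 * C`. -/
lemma integral_le_integral_add_of_levyProkhorovDist_lt (μ ν : Measure E)
    [IsProbabilityMeasure μ] [IsProbabilityMeasure ν] {h : E → ℝ} (hc : Continuous h)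
    {C δ η : ℝ} (hC : ∀ x, |h x| ≤ C) (hη : 0 ≤ η) (hδ : ∀ x y, dist x y < δ → |h x - h y| ≤ η)
    (hμν : levyProkhorovDist μ ν < δ) :
    ∫ x, h x ∂μ ≤ ∫ x, h x ∂ν + (η + 2 * C * δ) := by
  have hC0 : 0 ≤ C := (abs_nonneg _).trans (hC (μ.nonempty_of_neZero).some)
  have hδ0 : 0 < δ := lt_of_le_of_lt ENNReal.toReal_nonneg hμν
  have hb : ∀ x, 0 ≤ h x + C ∧ h x + C ≤ 2 * C := fun x =>
    ⟨by linarith [(abs_le.1 (hC x)).1], by linarith [(abs_le.1 (hC x)).2]⟩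
  let f : BoundedContinuousFunction E ℝ := BoundedContinuousFunction.ofNormedAddCommGroup
    (fun x => h x + C) (hc.add continuous_const) (2 * C) fun x => by
      rw [Real.norm_eq_abs, abs_of_nonneg (hb x).1]
      exact (hb x).2
  have hfn : ‖f‖ ≤ 2 * C := BoundedContinuousFunction.norm_ofNormedAddCommGroup_le _
    (by positivity) _
  have hlt : levyProkhorovEDist μ ν < ENNReal.ofReal δ :=
    (ENNReal.lt_ofReal_iff_toReal_lt (levyProkhorovEDist_ne_top μ ν)).2 hμν
  have h1 := BoundedContinuousFunction.integral_le_of_levyProkhorovEDist_lt μ ν hδ0 hlt f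
    (Eventually.of_forall fun x => (hb x).1)
  have ih : ∀ (ρ : Measure E) [IsProbabilityMeasure ρ], Integrable h ρ := fun ρ _ =>
    Integrable.of_bound hc.measurable.aestronglyMeasurable C (Eventually.of_forall hC)
  have h2 : ∫ t in Set.Ioc 0 ‖f‖, ν.real (Metric.thickening δ {a | t ≤ f a}) ≤
      ∫ x, (h x + C + η) ∂ν := by
    have hint : Integrable (fun x => h x + C + η) ν :=
      ((ih ν).add (integrable_const C)).add (integrable_const η)
    have hnn : 0 ≤ᵐ[ν] fun x => h x + C + η :=
      Eventually.of_forall fun x => add_nonneg (hb x).1 hη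
    have hbd : (fun x => h x + C + η) ≤ᵐ[ν] fun _ => ‖f‖ + η := Eventually.of_forall fun x => by
      have := f.apply_le_norm x
      exact add_le_add_left this η
    rw [Integrable.integral_eq_integral_Ioc_meas_le hint hnn hbd]
    have i2 : IntegrableOn (fun t => ν.real {a | t ≤ h a + C + η}) (Set.Ioc 0 (‖f‖ + η)) := by
      refine Measure.integrableOn_of_bounded (M := 1) measure_Ioc_lt_top.ne
        (Measurable.ennreal_toReal (Antitone.measurable ?_)).aestronglyMeasurable
        (Eventually.of_forall fun t => ?_)
      · exact fun _ _ hst => measure_mono fun _ h => hst.trans h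
      · rw [Real.norm_eq_abs, abs_of_nonneg measureReal_nonneg]
        exact measureReal_le_one
    have hsub : Set.Ioc 0 ‖f‖ ⊆ Set.Ioc 0 (‖f‖ + η) :=
      Set.Ioc_subset_Ioc_right (by linarith)
    refine le_trans (integral_mono_of_nonneg (Eventually.of_forall fun _ => measureReal_nonneg)
      (i2.mono_set hsub) (Eventually.of_forall fun t => ?_))
      (setIntegral_mono_set i2 (Eventually.of_forall fun _ => measureReal_nonneg)
        hsub.eventuallyLE)
    refine measureReal_mono fun x hx => ?_
    obtain ⟨y, hy, hxy⟩ := Metric.mem_thickening_iff.1 hx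
    have hy' : t ≤ h y + C := hy
    have := (abs_le.1 (hδ x y hxy)).1
    change t ≤ h x + C + η
    linarith
  have h3 : ∫ x, f x ∂μ = ∫ x, h x ∂μ + C := by
    change ∫ x, (h x + C) ∂μ = _
    rw [integral_add (ih μ) (integrable_const C)]
    simp
  have h4 : ∫ x, (h x + C + η) ∂ν = ∫ x, h x ∂ν + C + η := by
    have : (fun x => h x + C + η) = fun x => h x + (C + η) := by
      funext x
      ring
    rw [this, integral_add (ih ν) (integrable_const _)]
    simp [add_assoc]
  have h5 : δ * ‖f‖ ≤ δ * (2 * C) := mul_le_mul_of_nonneg_left hfn hδ0.le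
  linarith

lemma abs_integral_sub_le_of_levyProkhorovDist_lt (μ ν : Measure E)
    [IsProbabilityMeasure μ] [IsProbabilityMeasure ν] {h : E → ℝ} (hc : Continuous h)
    {C δ η : ℝ} (hC : ∀ x, |h x| ≤ C) (hη : 0 ≤ η) (hδ : ∀ x y, dist x y < δ → |h x - h y| ≤ η)
    (hμν : levyProkhorovDist μ ν < δ) :
    |∫ x, h x ∂μ - ∫ x, h x ∂ν| ≤ η + 2 * C * δ := by
  have h1 := integral_le_integral_add_of_levyProkhorovDist_lt μ ν hc hC hη hδ hμν
  have h2 := integral_le_integral_add_of_levyProkhorovDist_lt ν μ hc hC hη hδ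
    (levyProkhorovDist_comm μ ν ▸ hμν)
  rw [abs_le]
  constructor <;> linarith

end Integral

section Product

variable {E₁ E₂ : Type*} [PseudoMetricSpace E₁] [MeasurableSpace E₁] [OpensMeasurableSpace E₁]
  [PseudoMetricSpace E₂] [MeasurableSpace E₂] [OpensMeasurableSpace E₂]
  [OpensMeasurableSpace (E₁ × E₂)]

/-- Replacing the factors of a product measure one at a time: by Fubini, each replacement is an
average over the sections of `h`, which share the bound and the modulus of continuity of `h`. -/
lemma abs_integral_prod_sub_le_of_levyProkhorovDist_lt (μ₁ ν₁ : Measure E₁) (μ₂ ν₂ : Measure E₂)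
    [IsProbabilityMeasure μ₁] [IsProbabilityMeasure ν₁]
    [IsProbabilityMeasure μ₂] [IsProbabilityMeasure ν₂] {h : E₁ × E₂ → ℝ} (hc : Continuous h)
    {C δ η : ℝ} (hC : ∀ x, |h x| ≤ C) (hη : 0 ≤ η) (hδ : ∀ x y, dist x y < δ → |h x - h y| ≤ η)
    (h₁ : levyProkhorovDist μ₁ ν₁ < δ) (h₂ : levyProkhorovDist μ₂ ν₂ < δ) :
    |∫ z, h z ∂(μ₁.prod μ₂) - ∫ z, h z ∂(ν₁.prod ν₂)| ≤ 2 * (η + 2 * C * δ) := by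
  have ih : ∀ (ρ : Measure (E₁ × E₂)) [IsProbabilityMeasure ρ], Integrable h ρ := fun ρ _ =>
    Integrable.of_bound hc.measurable.aestronglyMeasurable C (Eventually.of_forall hC)
  have s₁ : |∫ z, h z ∂(μ₁.prod μ₂) - ∫ z, h z ∂(ν₁.prod μ₂)| ≤ η + 2 * C * δ := by
    rw [integral_prod_symm _ (ih _), integral_prod_symm _ (ih _),
      ← integral_sub (ih (μ₁.prod μ₂)).integral_prod_right (ih (ν₁.prod μ₂)).integral_prod_right]
    rw [← Real.norm_eq_abs]
    refine (norm_integral_le_of_norm_le_const (μ := μ₂) (C := η + 2 * C * δ)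
      (Eventually.of_forall fun y => ?_)).trans_eq (by rw [probReal_univ, mul_one])
    refine abs_integral_sub_le_of_levyProkhorovDist_lt μ₁ ν₁ (h := fun x => h (x, y))
      (by fun_prop) (fun x => hC (x, y)) hη (fun x x' hxx => hδ (x, y) (x', y) ?_) h₁
    rwa [dist_prod_same_right]
  have s₂ : |∫ z, h z ∂(ν₁.prod μ₂) - ∫ z, h z ∂(ν₁.prod ν₂)| ≤ η + 2 * C * δ := by
    rw [integral_prod _ (ih _), integral_prod _ (ih _),
      ← integral_sub (ih (ν₁.prod μ₂)).integral_prod_left (ih (ν₁.prod ν₂)).integral_prod_left]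
    rw [← Real.norm_eq_abs]
    refine (norm_integral_le_of_norm_le_const (μ := ν₁) (C := η + 2 * C * δ)
      (Eventually.of_forall fun x => ?_)).trans_eq (by rw [probReal_univ, mul_one])
    refine abs_integral_sub_le_of_levyProkhorovDist_lt μ₂ ν₂ (h := fun y => h (x, y))
      (by fun_prop) (fun y => hC (x, y)) hη (fun y y' hyy => hδ (x, y) (x, y') ?_) h₂
    rwa [dist_prod_same_left]
  have := abs_sub_le (∫ z, h z ∂(μ₁.prod μ₂)) (∫ z, h z ∂(ν₁.prod μ₂)) (∫ z, h z ∂(ν₁.prod ν₂))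
  linarith

/-- A joint law close to some product of probability measures is nearly the product of its own
marginals, as seen by `h`: projections do not increase the Lévy-Prokhorov distance. -/
lemma abs_integral_sub_integral_prod_marginals_le (μ : Measure (E₁ × E₂)) [IsProbabilityMeasure μ]
    (ν₁ : Measure E₁) (ν₂ : Measure E₂) [IsProbabilityMeasure ν₁] [IsProbabilityMeasure ν₂]
    {h : E₁ × E₂ → ℝ} (hc : Continuous h) {C δ η : ℝ} (hC : ∀ x, |h x| ≤ C) (hη : 0 ≤ η)
    (hδ : ∀ x y, dist x y < δ → |h x - h y| ≤ η)
    (hμν : levyProkhorovDist μ (ν₁.prod ν₂) < δ) :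
    |∫ z, h z ∂μ - ∫ z, h z ∂((μ.map Prod.fst).prod (μ.map Prod.snd))| ≤
      3 * (η + 2 * C * δ) := by
  have := Measure.isProbabilityMeasure_map (μ := μ) measurable_fst.aemeasurable
  have := Measure.isProbabilityMeasure_map (μ := μ) measurable_snd.aemeasurable
  have h₁ : levyProkhorovDist (μ.map Prod.fst) ν₁ < δ := by
    have := levyProkhorovDist_map_le μ (ν₁.prod ν₂) LipschitzWith.prod_fst measurable_fst
    rw [Measure.map_fst_prod, measure_univ, one_smul] at this
    exact this.trans_lt hμν
  have h₂ : levyProkhorovDist (μ.map Prod.snd) ν₂ < δ := by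
    have := levyProkhorovDist_map_le μ (ν₁.prod ν₂) LipschitzWith.prod_snd measurable_snd
    rw [Measure.map_snd_prod, measure_univ, one_smul] at this
    exact this.trans_lt hμν
  have a := abs_integral_sub_le_of_levyProkhorovDist_lt μ (ν₁.prod ν₂) hc hC hη hδ hμν
  have b := abs_integral_prod_sub_le_of_levyProkhorovDist_lt (μ.map Prod.fst) ν₁ (μ.map Prod.snd)
    ν₂ hc hC hη hδ h₁ h₂
  rw [abs_sub_comm] at b
  have := abs_sub_le (∫ z, h z ∂μ) (∫ z, h z ∂(ν₁.prod ν₂))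
    (∫ z, h z ∂((μ.map Prod.fst).prod (μ.map Prod.snd)))
  linarith

end Product

/-! ### Distances to the set of product measures -/

section Distance

variable {E₁ E₂ : Type*} [MeasurableSpace E₁] [MeasurableSpace E₂]

lemma prod_mem_productLaws (μ₁ : Measure E₁) (μ₂ : Measure E₂) [IsProbabilityMeasure μ₁]
    [IsProbabilityMeasure μ₂] : μ₁.prod μ₂ ∈ productLaws E₁ E₂ :=
  ⟨μ₁, μ₂, inferInstance, inferInstance, rfl⟩

lemma isProbabilityMeasure_of_mem_productLaws {ν : Measure (E₁ × E₂)}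
    (hν : ν ∈ productLaws E₁ E₂) : IsProbabilityMeasure ν := by
  obtain ⟨μ₁, μ₂, _, _, rfl⟩ := hν
  infer_instance

variable [MetricSpace E₁] [MetricSpace E₂]

lemma lpDistToProductsMax_nonneg (μ : Measure (E₁ × E₂)) : 0 ≤ lpDistToProductsMax μ :=
  Real.iInf_nonneg fun _ => ENNReal.toReal_nonneg

lemma lpDistToProductsSum_nonneg (μ : Measure (E₁ × E₂)) : 0 ≤ lpDistToProductsSum μ :=
  Real.iInf_nonneg fun _ => ENNReal.toReal_nonneg

lemma lpDistToProductsSum_le (μ : Measure (E₁ × E₂)) {ν : Measure (E₁ × E₂)}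
    (hν : ν ∈ productLaws E₁ E₂) :
    lpDistToProductsSum μ ≤
      levyProkhorovDist (μ.map (WithLp.toLp 1)) (ν.map (WithLp.toLp 1)) :=
  ciInf_le ⟨0, by rintro _ ⟨_, rfl⟩; exact ENNReal.toReal_nonneg⟩
    (⟨ν, hν⟩ : productLaws E₁ E₂)

/-- The maximum metric is dominated by the sum metric, hence so are the distances to the set of
product measures. -/
lemma lpDistToProductsMax_le_lpDistToProductsSum (μ : Measure (E₁ × E₂)) [IsProbabilityMeasure μ] :
    lpDistToProductsMax μ ≤ lpDistToProductsSum μ := by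
  refine ciInf_mono ⟨0, by rintro _ ⟨_, rfl⟩; exact ENNReal.toReal_nonneg⟩ fun ν => ?_
  have := isProbabilityMeasure_of_mem_productLaws ν.2
  have hm : Measurable (WithLp.toLp 1 : E₁ × E₂ → WithLp 1 (E₁ × E₂)) := WithLp.measurable_toLp 1 _
  have hm' : Measurable (WithLp.ofLp : WithLp 1 (E₁ × E₂) → E₁ × E₂) := WithLp.measurable_ofLp 1 _
  have key := levyProkhorovDist_map_le (μ.map (WithLp.toLp 1))
    ((ν : Measure (E₁ × E₂)).map (WithLp.toLp 1)) (WithLp.prod_lipschitzWith_ofLp 1 E₁ E₂) hm'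
  rw [Measure.map_map hm' hm, Measure.map_map hm' hm] at key
  have hid : (WithLp.ofLp : WithLp 1 (E₁ × E₂) → E₁ × E₂) ∘ WithLp.toLp 1 = id := rfl
  rwa [hid, Measure.map_id, Measure.map_id] at key

end Distance

/-! ### Asymptotic independence -/

section AsymptoticIndependence

variable {Ω E₁ E₂ : Type*} [MeasurableSpace Ω]
  [MetricSpace E₁] [TopologicalSpace.SeparableSpace E₁] [MeasurableSpace E₁] [BorelSpace E₁]
  [MetricSpace E₂] [TopologicalSpace.SeparableSpace E₂] [MeasurableSpace E₂] [BorelSpace E₂]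
  {P : Measure Ω} [IsProbabilityMeasure P] {X : ℕ → Ω → E₁} {Y : ℕ → Ω → E₂}

lemma AI1.tendsto_lpDistToProductsSum (hX : ∀ n, Measurable (X n)) (hY : ∀ n, Measurable (Y n))
    (H : AI1 P X Y) :
    Tendsto (fun n => lpDistToProductsSum (P.map fun ω => (X n ω, Y n ω))) atTop (𝓝 0) := by
  have : SecondCountableTopology E₁ := UniformSpace.secondCountable_of_separable E₁
  have : SecondCountableTopology E₂ := UniformSpace.secondCountable_of_separable E₂
  have h1 := fun n => Measure.isProbabilityMeasure_map (μ := P) (hX n).aemeasurable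
  have h2 := fun n => Measure.isProbabilityMeasure_map (μ := P) (hY n).aemeasurable
  have h3 := fun n =>
    Measure.isProbabilityMeasure_map (μ := P) ((hX n).prodMk (hY n)).aemeasurable
  have hm : Measurable (WithLp.toLp 1 : E₁ × E₂ → WithLp 1 (E₁ × E₂)) := WithLp.measurable_toLp 1 _
  have h4 := fun n => Measure.isProbabilityMeasure_map
    (μ := P.map fun ω => (X n ω, Y n ω)) hm.aemeasurable
  have h5 := fun n => Measure.isProbabilityMeasure_map
    (μ := (P.map (X n)).prod (P.map (Y n))) hm.aemeasurable
  have : SecondCountableTopology (WithLp 1 (E₁ × E₂)) :=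
    (WithLp.homeomorphProd 1 E₁ E₂).secondCountableTopology
  refine squeeze_zero (fun n => lpDistToProductsSum_nonneg _)
    (fun n => lpDistToProductsSum_le _ (prod_mem_productLaws (P.map (X n)) (P.map (Y n))))
    (tendsto_levyProkhorovDist_of_tendsto_integral_sub _ _ fun K h hh => ?_)
  have hmap : ∀ ρ : Measure (E₁ × E₂), ∫ x, h x ∂(ρ.map (WithLp.toLp 1)) =
      ∫ z, h (WithLp.toLp 1 z) ∂ρ := fun ρ =>
    integral_map hm.aemeasurable hh.1.continuous.measurable.aestronglyMeasurable
  simp only [hmap]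
  refine H (fun z => h (WithLp.toLp 1 z))
    (hh.1.uniformContinuous.comp (WithLp.prod_uniformContinuous_toLp 1 E₁ E₂)) ⟨1, fun z => ?_⟩
  rw [abs_le]
  exact ⟨by linarith [(hh.2 (WithLp.toLp 1 z)).1], (hh.2 (WithLp.toLp 1 z)).2⟩

lemma AI1.of_tendsto_lpDistToProductsMax (hX : ∀ n, Measurable (X n))
    (hY : ∀ n, Measurable (Y n))
    (H : Tendsto (fun n => lpDistToProductsMax (P.map fun ω => (X n ω, Y n ω))) atTop (𝓝 0)) :
    AI1 P X Y := by
  have : SecondCountableTopology E₁ := UniformSpace.secondCountable_of_separable E₁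
  have : SecondCountableTopology E₂ := UniformSpace.secondCountable_of_separable E₂
  have h1 := fun n => Measure.isProbabilityMeasure_map (μ := P) (hX n).aemeasurable
  have h2 := fun n => Measure.isProbabilityMeasure_map (μ := P) (hY n).aemeasurable
  have h3 := fun n =>
    Measure.isProbabilityMeasure_map (μ := P) ((hX n).prodMk (hY n)).aemeasurable
  intro h hh ⟨C, hC⟩
  have hC0 : 0 ≤ C := by
    have : Nonempty (E₁ × E₂) := (P.map fun ω => (X 0 ω, Y 0 ω)).nonempty_of_neZero
    exact (abs_nonneg _).trans (hC (Classical.arbitrary _))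
  refine Metric.tendsto_nhds.2 fun ε hε => ?_
  obtain ⟨δ₀, hδ₀, hmod⟩ := Metric.uniformContinuous_iff.1 hh (ε / 12) (by positivity)
  -- With `η = ε / 12`, this choice of `δ` makes `3 * (η + 2 * C * δ) ≤ ε / 2`.
  obtain ⟨δ, hδ, hδδ₀, hδC⟩ : ∃ δ > 0, δ ≤ δ₀ ∧ 2 * C * δ ≤ ε / 12 := by
    refine ⟨min δ₀ (ε / 12 / (2 * C + 1)), by positivity, min_le_left _ _, ?_⟩
    have h1 : (2 * C + 1) * min δ₀ (ε / 12 / (2 * C + 1)) ≤ ε / 12 := by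
      calc (2 * C + 1) * min δ₀ (ε / 12 / (2 * C + 1))
          ≤ (2 * C + 1) * (ε / 12 / (2 * C + 1)) :=
            mul_le_mul_of_nonneg_left (min_le_right _ _) (by positivity)
        _ = ε / 12 := by field_simp
    have h2 : 0 < min δ₀ (ε / 12 / (2 * C + 1)) := by positivity
    linarith
  filter_upwards [H.eventually_lt_const hδ] with n hn
  have : Nonempty (productLaws E₁ E₂) :=
    ⟨⟨_, prod_mem_productLaws (P.map (X n)) (P.map (Y n))⟩⟩
  obtain ⟨⟨_, ν₁, ν₂, _, _, rfl⟩, hν⟩ := exists_lt_of_ciInf_lt hn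
  have key := abs_integral_sub_integral_prod_marginals_le _ ν₁ ν₂ hh.continuous hC
    (show 0 ≤ ε / 12 by positivity) (fun x y hxy => (hmod (hxy.trans_le hδδ₀)).le) hν
  rw [Measure.map_map measurable_fst ((hX n).prodMk (hY n)),
    Measure.map_map measurable_snd ((hX n).prodMk (hY n))] at key
  rw [Real.dist_eq, sub_zero]
  refine lt_of_le_of_lt key ?_
  linarith

end AsymptoticIndependence

theorem mainTheorem5 {Ω E₁ E₂ : Type*} [MeasurableSpace Ω]
    [MetricSpace E₁] [CompleteSpace E₁] [TopologicalSpace.SeparableSpace E₁]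
    [MeasurableSpace E₁] [BorelSpace E₁]
    [MetricSpace E₂] [CompleteSpace E₂] [TopologicalSpace.SeparableSpace E₂]
    [MeasurableSpace E₂] [BorelSpace E₂]
    (P : Measure Ω) [IsProbabilityMeasure P]
    (X : ℕ → Ω → E₁) (Y : ℕ → Ω → E₂)
    (hX : ∀ n, Measurable (X n)) (hY : ∀ n, Measurable (Y n)) :
    (AI1 P X Y ↔
      Tendsto (fun n => lpDistToProductsMax (P.map fun ω => (X n ω, Y n ω))) atTop (𝓝 0)) ∧
    (AI1 P X Y ↔
      Tendsto (fun n => lpDistToProductsSum (P.map fun ω => (X n ω, Y n ω))) atTop (𝓝 0)) := by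
  have toSum := fun H : AI1 P X Y => H.tendsto_lpDistToProductsSum hX hY
  have toMax : Tendsto (fun n => lpDistToProductsSum (P.map fun ω => (X n ω, Y n ω))) atTop (𝓝 0) →
      Tendsto (fun n => lpDistToProductsMax (P.map fun ω => (X n ω, Y n ω))) atTop (𝓝 0) := by
    intro H
    refine squeeze_zero (fun n => lpDistToProductsMax_nonneg _) (fun n => ?_) H
    have := Measure.isProbabilityMeasure_map (μ := P) ((hX n).prodMk (hY n)).aemeasurable
    exact lpDistToProductsMax_le_lpDistToProductsSum _
  have ofMax := AI1.of_tendsto_lpDistToProductsMax (P := P) hX hY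
  exact ⟨⟨fun H => toMax (toSum H), ofMax⟩, ⟨toSum, fun H => ofMax (toMax H)⟩⟩
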